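/- Let $\mathcal K$ and $X$ be finite sets, where $X$ carries a group operation $+$, let $Z$ be a set, and let $k,q\ge 0$ be integers. A \emph{cipher} over $\mathcal K$ and $X$ is a map $E:\mathcal K\times X\to X$ such that $E_K:=E(K,\cdot)$ is a permutation of $X$ for every $K\in\mathcal K$; an \emph{ideal cipher} is a cipher $E^\ast$ chosen uniformly at random among all ciphers over $\mathcal K$ and $X$. A classical query to $E$ is either a forward query $(K,x)\mapsto E_K(x)$ or a backward query $(K,x)\mapsto E_K^{-1}(x)$. A quantum query to $E$ is one application of the unitary $$U_E|b\rangle|K\rangle|x\rangle|y\rangle=\begin{cases}|0\rangle|K\rangle|x\rangle|y+E_K(x)\rangle & \text{if } b=0,\\ |1\rangle|K\rangle|x\rangle|y+E_K^{-1}(x)\rangle & \text{if } b=1.\end{cases}$$ A $q$-query quantum algorithm starts in a fixed unit vector of a finite-dimensional space (query registers and a work register), applies $q$ quantum queries interleaved with unitaries that do not depend on $E$, measures in the computational basis, and outputs a function of the outcome. Let $\mathcal A$ be a quantum algorithm that makes $q$ quantum queries to an ideal cipher over $\mathcal K$ and $X$ and outputs elements of $\mathcal K^k\times X^k\times Z$,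 and let $R\subseteq\mathcal K^k\times X^k\times X^k\times Z$ be a relation. Then there exists a randomized algorithm $\mathcal B$ (computationally unbounded), making at most $k$ classical (forward or backward) queries, such that $$\Pr_{E^\ast}\left[(K_1,\dots,K_k,x_1,\dots,x_k,E^\ast_{K_1}(x_1),\dots,E^\ast_{K_k}(x_k),z)\in R : (K_1,\dots,K_k,x_1,\dots,x_k,z)\leftarrow\mathcal B^{E^\ast}\right]$$ $$\ge\ \frac{1-\frac{k^2}{|X|}}{(8q+1)^{2k}}\ \Pr_{E^\ast}\left[(K_1,\dots,K_k,x_1,\dots,x_k,E^\ast_{K_1}(x_1),\dots,E^\ast_{K_k}(x_k),z)\in R : (K_1,\dots,K_k,x_1,\dots,x_k,z)\leftarrow\mathcal A^{E^\ast}\right].$$ -/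

import Mathlib

/-- A cipher `E : K × X → X` over finite sets `K` (keys) and `X` (blocks): for every key `κ`, the
map `E κ : X → X` is a permutation of `X`. -/
abbrev Cipher (K X : Type*) : Type _ := K → Equiv.Perm X

/-- The classical answer of the two-way cipher oracle: `false` (bit `0`) is a forward query,
answered by `E_κ(x)`; `true` (bit `1`) is a backward query, answered by `E_κ⁻¹(x)`. -/
def Cipher.answer {K X : Type*} (E : Cipher K X) (b : Bool) (κ : K) (x : X) : X :=
  if b then (E κ).symm x else E κ x

/-- The expectation of `f E` when `E` is an ideal cipher, i.e. uniformly distributed over the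
(finite) set of all ciphers over `K` and `X`. -/
noncomputable def idealCipherExpectation (K X : Type*) [Fintype K] [DecidableEq K] [Fintype X]
    [DecidableEq X] (f : Cipher K X → ℝ) : ℝ :=
  (∑ E : Cipher K X, f E) / (Fintype.card (Cipher K X) : ℝ)

/-- The computational basis states `|b⟩|κ⟩|x⟩|y⟩|w⟩` of an algorithm with a query register
(direction `b`, key `κ`, input `x`, response `y`) and a work register with basis `W`. -/
abbrev BasisState (K X W : Type*) : Type _ := Bool × K × X × X × W

/-- The action of the cipher oracle on basis states:
`|b⟩|κ⟩|x⟩|y⟩|w⟩ ↦ |b⟩|κ⟩|x⟩|y + E_κ(x)⟩|w⟩` if `b = 0`, and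
`|b⟩|κ⟩|x⟩|y⟩|w⟩ ↦ |b⟩|κ⟩|x⟩|y + E_κ⁻¹(x)⟩|w⟩` if `b = 1`. -/
def Cipher.queryPerm {K X : Type*} [AddGroup X] (W : Type*) (E : Cipher K X) :
    Equiv.Perm (BasisState K X W) where
  toFun := fun ⟨b, κ, x, y, w⟩ => ⟨b, κ, x, y + E.answer b κ x, w⟩
  invFun := fun ⟨b, κ, x, y, w⟩ => ⟨b, κ, x, y - E.answer b κ x, w⟩
  left_inv := fun ⟨b, κ, x, y, w⟩ => by simp
  right_inv := fun ⟨b, κ, x, y, w⟩ => by simp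

/-- The oracle unitary `U_E` (acting as the identity on the work register). It is the linear
isometry that maps the basis vector of `i` to the basis vector of `E.queryPerm W i`. -/
noncomputable def Cipher.oracle {K X : Type*} [Fintype K] [Fintype X] [AddGroup X] (W : Type*)
    [Fintype W] (E : Cipher K X) :
    EuclideanSpace ℂ (BasisState K X W) ≃ₗᵢ[ℂ] EuclideanSpace ℂ (BasisState K X W) :=
  LinearIsometryEquiv.piLpCongrLeft 2 ℂ ℂ (E.queryPerm W)

/-- A quantum algorithm that makes `q` quantum queries to a cipher over `K` and `X` and has a
classical output in `Out`. It starts in a unit vector, alternates the oracle with unitaries that do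
not depend on the cipher, and finally measures all registers in the computational basis; the
output is a function of the measurement outcome. -/
structure QuantumAlgorithm (K X Out : Type*) [Fintype K] [Fintype X] (q : ℕ) where
  /-- the basis of the work register -/
  W : Type
  [fintypeW : Fintype W]
  /-- the state before the first query -/
  start : EuclideanSpace ℂ (BasisState K X W)
  norm_start : ‖start‖ = 1
  /-- `unitary i` is applied directly after the query with (zero-based) number `i` -/
  unitary : Fin q →
    (EuclideanSpace ℂ (BasisState K X W) ≃ₗᵢ[ℂ] EuclideanSpace ℂ (BasisState K X W))
  /-- the output computed from the outcome of the final measurement -/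
  out : BasisState K X W → Out

attribute [instance] QuantumAlgorithm.fintypeW

namespace QuantumAlgorithm

variable {K X Out : Type*} [Fintype K] [Fintype X] [AddGroup X] {q : ℕ}

/-- The state of the algorithm with oracle `E` after its first `n` queries, where `n ≤ q`. -/
noncomputable def stateAfter (A : QuantumAlgorithm K X Out q) (E : Cipher K X) :
    (n : ℕ) → n ≤ q → EuclideanSpace ℂ (BasisState K X A.W)
  | 0, _ => A.start
  | n + 1, h => A.unitary ⟨n, h⟩ (E.oracle A.W (A.stateAfter E n (Nat.le_of_succ_le h)))

open Classical in
/-- The probability that the output of the algorithm with oracle `E` lies in `S`, by the Born rule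
for the measurement of the final state in the computational basis. -/
noncomputable def outputProb (A : QuantumAlgorithm K X Out q) (E : Cipher K X) (S : Set Out) : ℝ :=
  ∑ i : BasisState K X A.W, if A.out i ∈ S then ‖A.stateAfter E q le_rfl i‖ ^ 2 else 0

end QuantumAlgorithm

/-- A randomized algorithm that makes at most `n` classical queries (forward or backward) to a
cipher over `K` and `X` and has its output in `Out`. -/
inductive ClassicalAlgorithm (K X Out : Type*) : ℕ → Type _
  /-- stop with an output; the remaining queries are left unused -/
  | output {n : ℕ} (o : Out) : ClassicalAlgorithm K X Out n
  /-- sample `i` from a distribution on finitely many values and continue according to `i` -/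
  | toss {n m : ℕ} (μ : PMF (Fin m)) (next : Fin m → ClassicalAlgorithm K X Out n) :
      ClassicalAlgorithm K X Out n
  /-- make one query in direction `b` and continue according to the answer -/
  | query {n : ℕ} (b : Bool) (κ : K) (x : X) (next : X → ClassicalAlgorithm K X Out n) :
      ClassicalAlgorithm K X Out (n + 1)

namespace ClassicalAlgorithm

variable {K X Out : Type*}

/-- The output distribution of the algorithm with oracle `E`. -/
noncomputable def run (E : Cipher K X) : {n : ℕ} → ClassicalAlgorithm K X Out n → PMF Out
  | _, output o => PMF.pure o
  | _, toss μ next => μ.bind fun i => (next i).run E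
  | _, query b κ x next => (next (E.answer b κ x)).run E

/-- The probability that the output of the algorithm with oracle `E` lies in `S`. -/
noncomputable def outputProb {n : ℕ} (B : ClassicalAlgorithm K X Out n) (E : Cipher K X)
    (S : Set Out) : ℝ :=
  ((B.run E).toOuterMeasure S).toReal

end ClassicalAlgorithm

/-- The outputs `(K₁, …, K_k, x₁, …, x_k, z)` that win with respect to the relation `R` and the
cipher `E`: `(K₁, …, K_k, x₁, …, x_k, E_{K₁}(x₁), …, E_{K_k}(x_k), z) ∈ R`. -/
def winningOutputs {K X Z : Type*} {k : ℕ}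
    (R : Set ((Fin k → K) × (Fin k → X) × (Fin k → X) × Z)) (E : Cipher K X) :
    Set ((Fin k → K) × (Fin k → X) × Z) :=
  {o | (o.1, o.2.1, (fun i => E (o.1 i) (o.2.1 i)), o.2.2) ∈ R}

/-! Let `F` be the real cipher, `G` a uniformly random one, and `T` the set of at most `k` points
output by the quantum algorithm. Call the pair good if no value of `G` on `T` is a value of `F` on
`T` under the same key. Exchanging these values by one involution, composed with both ciphers,
permutes the good pairs. Hence `H`, which is `G` with the values of `F` on `T` swapped in, is
distributed like `G` given goodness, and bad pairs cost at most k²/|X| (`sum_goodPosition_ge`). As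
`H` and `F` agree on `T`, an output with points `T` wins for both or for neither.

A run with `H` expands into runs with `G`. The two oracles differ only on four query inputs per
point of `T`, so the oracle of `H` is that of `G` plus signed corrections on these inputs
(`Reprogrammed.oracle_eq`). In each resulting branch, measuring a query input and making one
classical query to `F` reveals the point to be reprogrammed. Recombining the interfering branches
costs (8q+1)^k by Cauchy–Schwarz (`Reprogrammed.weightOn_evolve_le`). Sampling a branch, without
knowledge of `T`, costs another (8q+1)^k (`achieves_simWeight`). -/

/-! ### Classical success probabilities and mixtures of strategies -/

namespace ClassicalAlgorithm

variable {K X Out : Type*}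

theorem outputProb_nonneg {n : ℕ} (B : ClassicalAlgorithm K X Out n) (E : Cipher K X)
    (S : Set Out) : 0 ≤ B.outputProb E S :=
  ENNReal.toReal_nonneg

theorem outputProb_output {n : ℕ} (o : Out) (E : Cipher K X) {S : Set Out} (h : o ∈ S) :
    (output o : ClassicalAlgorithm K X Out n).outputProb E S = 1 := by
  classical
  simp [outputProb, run, PMF.toOuterMeasure_pure_apply, h]

theorem outputProb_toss {n m : ℕ} (μ : PMF (Fin m)) (next : Fin m → ClassicalAlgorithm K X Out n)
    (E : Cipher K X) (S : Set Out) :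
    (toss μ next).outputProb E S = ∑ i, (μ i).toReal * (next i).outputProb E S := by
  unfold outputProb
  rw [run, PMF.toOuterMeasure_bind_apply, tsum_fintype, ENNReal.toReal_sum]
  · simp [ENNReal.toReal_mul]
  · intro i _
    refine ENNReal.mul_ne_top (PMF.apply_ne_top _ _) (ne_top_of_le_ne_top ENNReal.one_ne_top ?_)
    exact (MeasureTheory.measure_mono (Set.subset_univ S)).trans_eq
      ((PMF.toOuterMeasure_apply_eq_one_iff _ _).2 (Set.subset_univ _))

theorem outputProb_query {n : ℕ} (b : Bool) (κ : K) (x : X)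
    (next : X → ClassicalAlgorithm K X Out n) (E : Cipher K X) (S : Set Out) :
    (query b κ x next).outputProb E S = (next (E.answer b κ x)).outputProb E S := by
  simp [outputProb, run]

end ClassicalAlgorithm

/-- Some classical algorithm with at most `n` queries wins with probability at least `f E / c`
for every cipher `E`, where winning means an output in `S E`. -/
def Achieves {K X Out : Type*} (S : Cipher K X → Set Out) (n : ℕ) (c : ℝ)
    (f : Cipher K X → ℝ) : Prop :=
  0 ≤ c ∧ ∃ B : ClassicalAlgorithm K X Out n, ∀ E, f E ≤ c * B.outputProb E (S E)

namespace Achieves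

variable {K X Out : Type*} {S : Cipher K X → Set Out} {n : ℕ}

theorem mono {c c' : ℝ} {f f' : Cipher K X → ℝ} (h : Achieves S n c f) (hc : c ≤ c')
    (hf : ∀ E, f' E ≤ f E) : Achieves S n c' f' := by
  obtain ⟨h0, B, hB⟩ := h
  exact ⟨h0.trans hc, B, fun E => (hf E).trans <| (hB E).trans <|
    mul_le_mul_of_nonneg_right hc (B.outputProb_nonneg E _)⟩

open Classical in
theorem output (o : Out) {c : ℝ} (hc : 0 ≤ c) :
    Achieves S n c (fun E => if o ∈ S E then c else 0) := by
  refine ⟨hc, .output o, fun E => ?_⟩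
  beta_reduce
  split_ifs with h
  · rw [ClassicalAlgorithm.outputProb_output o E h, mul_one]
  · exact mul_nonneg hc (ClassicalAlgorithm.outputProb_nonneg _ _ _)

theorem query (b : Bool) (κ : K) (x : X) {c : ℝ} {f : X → Cipher K X → ℝ}
    (hc : 0 ≤ c) (h : ∀ y, Achieves S n c (f y)) :
    Achieves S (n + 1) c (fun E => f (E.answer b κ x) E) := by
  choose _ B hB using h
  refine ⟨hc, .query b κ x B, fun E => ?_⟩
  rw [ClassicalAlgorithm.outputProb_query]
  exact hB _ E

/-- Strategy `i` is run with probability `c i / ∑ i, c i`, so normalisation costs exactly the sum of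
the budgets. -/
theorem sum [Nonempty Out] {ι : Type*} [Fintype ι] {c : ι → ℝ} {f : ι → Cipher K X → ℝ}
    (h : ∀ i, Achieves S n (c i) (f i)) :
    Achieves S n (∑ i, c i) (fun E => ∑ i, f i E) := by
  choose hc B hB using h
  have hC : 0 ≤ ∑ i, c i := Finset.sum_nonneg fun i _ => hc i
  refine ⟨hC, ?_⟩
  rcases hC.eq_or_lt with h0 | hpos
  -- With zero total budget no `f i` is positive, so any output serves.
  · refine ⟨.output (Classical.arbitrary Out), fun E => ?_⟩
    rw [← h0, zero_mul]
    have hz := (Finset.sum_eq_zero_iff_of_nonneg fun i _ => hc i).1 h0.symm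
    refine Finset.sum_nonpos fun i hi => ?_
    simpa [hz i hi] using hB i E
  · let e := Fintype.equivFin ι
    have hsum : ∑ i : Fin (Fintype.card ι), ENNReal.ofReal (c (e.symm i) / ∑ i, c i) = 1 := by
      rw [← ENNReal.ofReal_sum_of_nonneg fun i _ => div_nonneg (hc _) hC,
        e.symm.sum_comp (fun i => c i / ∑ i, c i), ← Finset.sum_div, div_self hpos.ne',
        ENNReal.ofReal_one]
    refine ⟨.toss (PMF.ofFintype _ hsum) fun i => B (e.symm i), fun E => ?_⟩
    rw [ClassicalAlgorithm.outputProb_toss]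
    simp only [PMF.ofFintype_apply, ENNReal.toReal_ofReal (div_nonneg (hc _) hC)]
    rw [e.symm.sum_comp (fun i => c i / (∑ i, c i) * (B i).outputProb E (S E)), Finset.mul_sum]
    refine Finset.sum_le_sum fun i _ => (hB i E).trans_eq ?_
    field_simp

end Achieves

/-! ### Decomposition of states -/

section States

variable {K X W : Type*}

/-- The query input (direction, key, block) of a basis state. -/
def BasisState.input (i : BasisState K X W) : Bool × K × X := (i.1, i.2.1, i.2.2.1)

open Classical in
/-- The restriction of `φ` to the basis states in `Γ`. -/
noncomputable def restrictTo (Γ : Set (BasisState K X W)) :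
    EuclideanSpace ℂ (BasisState K X W) →ₗ[ℂ] EuclideanSpace ℂ (BasisState K X W) where
  toFun φ := WithLp.toLp 2 fun i => if i ∈ Γ then φ i else 0
  map_add' φ ψ := by
    ext i
    by_cases h : i ∈ Γ <;> simp [h]
  map_smul' c φ := by
    ext i
    by_cases h : i ∈ Γ <;> simp [h]

open Classical in
theorem restrictTo_apply (Γ : Set (BasisState K X W)) (φ : EuclideanSpace ℂ (BasisState K X W))
    (i : BasisState K X W) : restrictTo Γ φ i = if i ∈ Γ then φ i else 0 := rfl

variable [Fintype K] [Fintype X] [Fintype W]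

open Classical in
/-- The squared norm of the part of `φ` that is supported on `Γ`. -/
noncomputable def weightOn (Γ : Set (BasisState K X W))
    (φ : EuclideanSpace ℂ (BasisState K X W)) : ℝ :=
  ∑ i, if i ∈ Γ then ‖φ i‖ ^ 2 else 0

theorem weightOn_nonneg (Γ : Set (BasisState K X W)) (φ : EuclideanSpace ℂ (BasisState K X W)) :
    0 ≤ weightOn Γ φ :=
  Finset.sum_nonneg fun i _ => by split_ifs <;> positivity

theorem norm_restrictTo_sq (Γ : Set (BasisState K X W))
    (φ : EuclideanSpace ℂ (BasisState K X W)) : ‖restrictTo Γ φ‖ ^ 2 = weightOn Γ φ := by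
  rw [EuclideanSpace.norm_sq_eq, weightOn]
  refine Finset.sum_congr rfl fun i _ => ?_
  rw [restrictTo_apply]
  split_ifs <;> simp

theorem weightOn_neg (Γ : Set (BasisState K X W)) (φ : EuclideanSpace ℂ (BasisState K X W)) :
    weightOn Γ (-φ) = weightOn Γ φ := by
  simp [weightOn]

/-- Weighted Cauchy–Schwarz. The weights `A i` allow branches with fewer points left to learn to be
charged less. -/
theorem weightOn_sum_le {ι : Type*} (Γ : Set (BasisState K X W)) (s : Finset ι)
    (v : ι → EuclideanSpace ℂ (BasisState K X W)) {A α : ι → ℝ} (hA : ∀ i, 0 ≤ A i)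
    (hα : ∀ i, 0 ≤ α i) (h : ∀ i ∈ s, weightOn Γ (v i) ≤ A i * α i) :
    weightOn Γ (∑ i ∈ s, v i) ≤ (∑ i ∈ s, A i) * ∑ i ∈ s, α i := by
  rw [← norm_restrictTo_sq, map_sum]
  refine (pow_le_pow_left₀ (norm_nonneg _) (norm_sum_le _ _) 2).trans ?_
  refine Finset.sum_sq_le_sum_mul_sum_of_sq_le_mul s (fun i _ => hA i) (fun i _ => hα i)
    fun i hi => ?_
  rw [norm_restrictTo_sq]
  exact h i hi

/-- The projection of `φ` onto the basis states with query input `a`. -/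
noncomputable def projectInput (a : Bool × K × X) :
    EuclideanSpace ℂ (BasisState K X W) →ₗ[ℂ] EuclideanSpace ℂ (BasisState K X W) :=
  restrictTo {i | i.input = a}

theorem sum_norm_projectInput_sq (φ : EuclideanSpace ℂ (BasisState K X W)) :
    ∑ a, ‖projectInput a φ‖ ^ 2 = ‖φ‖ ^ 2 := by
  classical
  simp only [projectInput, norm_restrictTo_sq, weightOn]
  rw [Finset.sum_comm, EuclideanSpace.norm_sq_eq]
  refine Finset.sum_congr rfl fun i _ => ?_
  simp

variable [AddGroup X]

theorem Cipher.oracle_apply (E : Cipher K X) (φ : EuclideanSpace ℂ (BasisState K X W))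
    (b : Bool) (κ : K) (x y : X) (w : W) :
    E.oracle W φ (b, κ, x, y, w) = φ (b, κ, x, y - E.answer b κ x, w) := by
  rfl

/-- The state reached from `φ` by alternating the oracle with the unitaries in a list. -/
noncomputable def evolve (E : Cipher K X) :
    List (EuclideanSpace ℂ (BasisState K X W) ≃ₗᵢ[ℂ] EuclideanSpace ℂ (BasisState K X W)) →
    EuclideanSpace ℂ (BasisState K X W) →ₗ[ℂ] EuclideanSpace ℂ (BasisState K X W)
  | [] => LinearMap.id
  | U :: Us => evolve E Us ∘ₗ U.toLinearEquiv.toLinearMap ∘ₗ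
      (E.oracle W).toLinearEquiv.toLinearMap

theorem evolve_nil (E : Cipher K X) (φ : EuclideanSpace ℂ (BasisState K X W)) :
    evolve E [] φ = φ := rfl

theorem evolve_cons (E : Cipher K X)
    (U : EuclideanSpace ℂ (BasisState K X W) ≃ₗᵢ[ℂ] EuclideanSpace ℂ (BasisState K X W))
    (Us : List (EuclideanSpace ℂ (BasisState K X W) ≃ₗᵢ[ℂ] EuclideanSpace ℂ (BasisState K X W)))
    (φ : EuclideanSpace ℂ (BasisState K X W)) :
    evolve E (U :: Us) φ = evolve E Us (U (E.oracle W φ)) := rfl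

theorem evolve_append (E : Cipher K X)
    (Us Vs : List (EuclideanSpace ℂ (BasisState K X W) ≃ₗᵢ[ℂ]
      EuclideanSpace ℂ (BasisState K X W)))
    (φ : EuclideanSpace ℂ (BasisState K X W)) :
    evolve E (Us ++ Vs) φ = evolve E Vs (evolve E Us φ) := by
  induction Us generalizing φ with
  | nil => rfl
  | cons U Us ih => exact ih _

end States

/-- `stateAfter` peels off the last query, `evolve` the first; the latter suits induction over the
remaining queries from an arbitrary vector. -/
theorem QuantumAlgorithm.stateAfter_eq_evolve {K X Out : Type*} [Fintype K] [Fintype X]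
    [AddGroup X] {q : ℕ} (A : QuantumAlgorithm K X Out q) (E : Cipher K X) (n : ℕ) (h : n ≤ q) :
    A.stateAfter E n h = evolve E (List.ofFn fun i : Fin n => A.unitary (i.castLE h)) A.start := by
  induction n with
  | zero => simp [stateAfter, evolve_nil]
  | succ n ih =>
    rw [List.ofFn_succ', List.concat_eq_append, evolve_append, evolve_cons, evolve_nil,
      stateAfter, ih]
    rfl

theorem QuantumAlgorithm.outputProb_eq_weightOn {K X Out : Type*} [Fintype K] [Fintype X]
    [AddGroup X] {q : ℕ} (A : QuantumAlgorithm K X Out q) (E : Cipher K X) (S : Set Out) :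
    A.outputProb E S = weightOn (A.out ⁻¹' S) (evolve E (List.ofFn A.unitary) A.start) := by
  rw [outputProb, A.stateAfter_eq_evolve]
  rfl

/-! ### The measuring simulation -/

section Simulation

variable {K X W : Type*} [DecidableEq K] [DecidableEq X]

/-- The cipher `G` with its value at `(κ, x)` changed to `y` by swapping two output values. -/
def Cipher.reprogram (G : Cipher K X) (κ : K) (x y : X) : Cipher K X :=
  Function.update G κ ((G κ).trans (Equiv.swap (G κ x) y))

/-- The cipher `G` reprogrammed to give the answer `r` to the query `(b, κ, u)`. -/
def Cipher.learn (G : Cipher K X) (b : Bool) (κ : K) (u r : X) : Cipher K X :=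
  if b then G.reprogram κ r u else G.reprogram κ u r

/-- For a query input `(b, κ, u)`, either this query itself, or the query in the opposite
direction at the answer that `G` gives to it. -/
def Cipher.companion (G : Cipher K X) (s : Bool) (a : Bool × K × X) : Bool × K × X :=
  if s then (!a.1, a.2.1, G.answer a.1 a.2.1 a.2.2) else a

/-- The cipher `G` after the companion query to the input `a` has been answered by `F`. -/
def Cipher.update (F G : Cipher K X) (s : Bool) (a : Bool × K × X) : Cipher K X :=
  G.learn (G.companion s a).1 (G.companion s a).2.1 (G.companion s a).2.2
    (F.answer (G.companion s a).1 (G.companion s a).2.1 (G.companion s a).2.2)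

variable [Fintype K] [Fintype X] [Fintype W] [AddGroup X]

/-- The total weight on `Γ` of the branches of the simulation: before every query, the current
cipher `G` may be used, or (at most `m` times) the query input is measured, a point of the real
cipher `F` is learned and `G` is reprogrammed, either directly before or directly after the query.
-/
noncomputable def simWeight (Γ : Set (BasisState K X W)) (F : Cipher K X) :
    List (EuclideanSpace ℂ (BasisState K X W) ≃ₗᵢ[ℂ] EuclideanSpace ℂ (BasisState K X W)) →
    ℕ → Cipher K X → EuclideanSpace ℂ (BasisState K X W) → ℝ
  | [], _, _, φ => weightOn Γ φ
  | U :: Us, 0, G, φ => simWeight Γ F Us 0 G (U (G.oracle W φ))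
  | U :: Us, m + 1, G, φ => simWeight Γ F Us (m + 1) G (U (G.oracle W φ)) +
      ∑ j : (Bool × Bool) × (Bool × K × X),
        simWeight Γ F Us m (F.update G j.1.1 j.2)
          (U ((if j.1.2 then F.update G j.1.1 j.2 else G).oracle W (projectInput j.2 φ)))

theorem simWeight_nonneg (Γ : Set (BasisState K X W)) (F : Cipher K X)
    (Us : List (EuclideanSpace ℂ (BasisState K X W) ≃ₗᵢ[ℂ] EuclideanSpace ℂ (BasisState K X W)))
    (m : ℕ) (G : Cipher K X) (φ : EuclideanSpace ℂ (BasisState K X W)) :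
    0 ≤ simWeight Γ F Us m G φ := by
  induction Us generalizing m G φ with
  | nil => exact weightOn_nonneg _ _
  | cons U Us ih =>
    cases m with
    | zero => exact ih _ _ _
    | succ m => exact add_nonneg (ih _ _ _) (Finset.sum_nonneg fun _ _ => ih _ _ _)

/-- Additivity in `Γ` allows the comparison with `H` to be made for each set of output points
separately, although the simulation does not know that set. -/
theorem simWeight_eq_sum_fiber {ι : Type*} [Fintype ι] (p : BasisState K X W → ι)
    (Γ : Set (BasisState K X W)) (F : Cipher K X)
    (Us : List (EuclideanSpace ℂ (BasisState K X W) ≃ₗᵢ[ℂ] EuclideanSpace ℂ (BasisState K X W)))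
    (m : ℕ) (G : Cipher K X) (φ : EuclideanSpace ℂ (BasisState K X W)) :
    simWeight Γ F Us m G φ = ∑ t, simWeight (Γ ∩ p ⁻¹' {t}) F Us m G φ := by
  classical
  induction Us generalizing m G φ with
  | nil =>
    simp only [simWeight, weightOn]
    rw [Finset.sum_comm]
    refine Finset.sum_congr rfl fun i _ => ?_
    by_cases h : i ∈ Γ <;> simp [h]
  | cons U Us ih =>
    cases m with
    | zero => exact ih _ _ _
    | succ m =>
      simp only [simWeight]
      rw [Finset.sum_add_distrib, Finset.sum_comm, ih]
      exact congrArg _ (Finset.sum_congr rfl fun j _ => ih _ _ _)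

/-- Branches are unnormalised vectors with squared norms as budgets. Measuring the input splits ‖φ‖²
without loss, and the two Boolean flags multiply it by 4; the constant 8 leaves room. -/
theorem achieves_simWeight {Out : Type*} [Nonempty Out] (S : Cipher K X → Set Out)
    (out : BasisState K X W → Out)
    (Us : List (EuclideanSpace ℂ (BasisState K X W) ≃ₗᵢ[ℂ] EuclideanSpace ℂ (BasisState K X W)))
    (m : ℕ) (G : Cipher K X) (φ : EuclideanSpace ℂ (BasisState K X W)) :
    Achieves S m ((8 * (Us.length : ℝ) + 1) ^ m * ‖φ‖ ^ 2)
      (fun F => simWeight (out ⁻¹' S F) F Us m G φ) := by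
  classical
  induction Us generalizing m G φ with
  | nil =>
    refine (Achieves.sum fun i => Achieves.output (out i) (sq_nonneg ‖φ i‖)).mono ?_ ?_
    · simp [EuclideanSpace.norm_sq_eq]
    · intro E
      exact le_of_eq rfl
  | cons U Us ih =>
    cases m with
    | zero =>
      refine (ih 0 G (U (G.oracle W φ))).mono ?_ fun _ => le_rfl
      simp
    | succ m =>
      have hq (j : (Bool × Bool) × (Bool × K × X)) :
          Achieves S (m + 1) ((8 * (Us.length : ℝ) + 1) ^ m * ‖projectInput j.2 φ‖ ^ 2)
            (fun F => simWeight (out ⁻¹' S F) F Us m (F.update G j.1.1 j.2)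
              (U ((if j.1.2 then F.update G j.1.1 j.2 else G).oracle W
                (projectInput j.2 φ)))) := by
        -- Up to the final winning condition, the branch depends on `F` only through the answer `r`.
        refine Achieves.query (G.companion j.1.1 j.2).1 (G.companion j.1.1 j.2).2.1
          (G.companion j.1.1 j.2).2.2 (by positivity) (f := fun r F =>
            simWeight (out ⁻¹' S F) F Us m (G.learn (G.companion j.1.1 j.2).1
              (G.companion j.1.1 j.2).2.1 (G.companion j.1.1 j.2).2.2 r)
              (U ((if j.1.2 then G.learn (G.companion j.1.1 j.2).1 (G.companion j.1.1 j.2).2.1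
                (G.companion j.1.1 j.2).2.2 r else G).oracle W (projectInput j.2 φ))))
          fun r => ?_
        refine (ih m _ _).mono ?_ fun _ => le_rfl
        simp
      have h := Achieves.sum (ι := Option ((Bool × Bool) × (Bool × K × X)))
        (c := fun o => o.elim ((8 * (Us.length : ℝ) + 1) ^ (m + 1) * ‖φ‖ ^ 2)
          fun j => (8 * (Us.length : ℝ) + 1) ^ m * ‖projectInput j.2 φ‖ ^ 2)
        (f := fun o => o.elim
          (fun F => simWeight (out ⁻¹' S F) F Us (m + 1) G (U (G.oracle W φ)))
          fun j F => simWeight (out ⁻¹' S F) F Us m (F.update G j.1.1 j.2)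
              (U ((if j.1.2 then F.update G j.1.1 j.2 else G).oracle W (projectInput j.2 φ))))
        (S := S) (n := m + 1) fun o => ?_
      · refine h.mono ?_ fun F => ?_
        · simp only [Fintype.sum_option, Option.elim]
          rw [← Finset.mul_sum, Fintype.sum_prod_type]
          simp only [sum_norm_projectInput_sq, List.length_cons, Nat.cast_add, Nat.cast_one]
          simp only [Finset.sum_const, Finset.card_univ, Fintype.card_prod, Fintype.card_bool,
            nsmul_eq_mul]
          have hx : (0 : ℝ) ≤ 8 * Us.length + 1 := by positivity
          have := pow_le_pow_left₀ hx (by linarith : (8 * (Us.length : ℝ) + 1) ≤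
            8 * (Us.length + 1) + 1) m
          rw [pow_succ (8 * (Us.length : ℝ) + 1), pow_succ (8 * ((Us.length : ℝ) + 1) + 1)]
          have h1 := mul_le_mul_of_nonneg_right this
            (by positivity : (0 : ℝ) ≤ (8 * (Us.length + 1) + 1) * ‖φ‖ ^ 2)
          have h2 : 0 ≤ (8 * (Us.length : ℝ) + 1) ^ m * ‖φ‖ ^ 2 := by positivity
          push_cast
          linarith
        · simp only [Fintype.sum_option, Option.elim, simWeight]
          exact le_rfl
      · cases o with
        | none => simpa using ih (m + 1) G (U (G.oracle W φ))
        | some j => exact hq j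

end Simulation

/-! ### Reprogramming in good position -/

/-- The first two terms of the binomial expansion. -/
theorem pow_succ_add_mul_le {a d : ℝ} (ha : 0 ≤ a) (hd : 0 ≤ d) (t : ℕ) :
    a ^ (t + 1) + (t + 1) * (d * a ^ t) ≤ (a + d) ^ (t + 1) := by
  induction t with
  | zero => simp
  | succ t ih =>
    have h1 := mul_le_mul_of_nonneg_right ih (add_nonneg ha hd)
    have h2 : 0 ≤ (t + 1) * (d * a ^ t) * d := by positivity
    rw [pow_succ (a + d)]
    refine le_trans ?_ h1
    push_cast
    linarith [pow_succ a (t + 1), pow_succ a t,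
      show (t + 1 + 1) * (d * a ^ (t + 1)) = (t + 1) * (d * a ^ t) * a + d * a ^ (t + 1) by ring]

section Reprogrammed

variable {K X : Type*}

/-- `H` arises from `G` by changing the value at every point of `T` to the value of `F`, where none
of the old values is one of the new values. -/
structure Reprogrammed (F G H : Cipher K X) (T : Finset (K × X)) : Prop where
  value : ∀ κ x, (κ, x) ∈ T → H κ x = F κ x
  swapped : ∀ κ x, (κ, x) ∈ T → H κ ((G κ).symm (F κ x)) = G κ x
  other : ∀ κ u, (κ, u) ∉ T → (κ, (F κ).symm (G κ u)) ∉ T → H κ u = G κ u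
  good : ∀ κ x x', (κ, x) ∈ T → (κ, x') ∈ T → G κ x ≠ F κ x'

/-- The four query inputs at which reprogramming `G` at a point to the value of `F` matters. -/
def Cipher.inputOf (F G : Cipher K X) (p : K × X) (b s : Bool) : Bool × K × X :=
  (b, p.1, if b then (if s then G p.1 p.2 else F p.1 p.2)
    else if s then (G p.1).symm (F p.1 p.2) else p.2)

namespace Reprogrammed

variable {F G H : Cipher K X} {T : Finset (K × X)}

theorem eq_of_empty (h : Reprogrammed F G H ∅) : H = G := by
  funext κ
  ext u
  exact h.other κ u (by simp) (by simp)

/-- Good position separates the inputs with different `s`; injectivity of the permutations separates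
those with equal `s`. -/
theorem inputOf_injective (h : Reprogrammed F G H T) {p p' : K × X} (hp : p ∈ T) (hp' : p' ∈ T)
    {b b' s s' : Bool} (e : F.inputOf G p b s = F.inputOf G p' b' s') :
    p = p' ∧ b = b' ∧ s = s' := by
  obtain ⟨κ, x⟩ := p
  obtain ⟨κ', x'⟩ := p'
  simp only [Cipher.inputOf, Prod.mk.injEq] at e
  obtain ⟨rfl, rfl, e⟩ := e
  have h1 := h.good κ x x' hp hp'
  have h2 := h.good κ x' x hp' hp
  cases b <;> cases s <;> cases s' <;>
    simp_all [Equiv.eq_symm_apply, eq_comm]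

theorem answer_eq (h : Reprogrammed F G H T) {b : Bool} {κ : K} {u : X}
    (hu : ∀ p ∈ T, ∀ s, (b, κ, u) ≠ F.inputOf G p b s) :
    H.answer b κ u = G.answer b κ u := by
  cases b with
  | false =>
    refine h.other κ u (fun hm => hu _ hm false rfl) fun hm => hu _ hm true ?_
    simp [Cipher.inputOf]
  | true =>
    simp only [Cipher.answer, if_true]
    rw [Equiv.symm_apply_eq, h.other, Equiv.apply_symm_apply]
    · intro hm
      exact hu _ hm true (by simp [Cipher.inputOf])
    · intro hm
      exact hu _ hm false (by simp [Cipher.inputOf])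

end Reprogrammed

variable [DecidableEq K] [DecidableEq X]

theorem Cipher.reprogram_apply (G : Cipher K X) (κ : K) (x y : X) (κ' : K) (u : X) :
    G.reprogram κ x y κ' u = if κ' = κ then Equiv.swap (G κ x) y (G κ u) else G κ' u := by
  unfold reprogram
  by_cases h : κ' = κ
  · subst h
    simp
  · simp [h]

namespace Reprogrammed

variable {F G H : Cipher K X} {T : Finset (K × X)}

/-- In good position the swaps for different points are disjoint, so one of them leaves the others
intact. In the induction `G` moves towards a fixed `H`. -/
theorem erase (h : Reprogrammed F G H T) {κ : K} {x : X} (hp : (κ, x) ∈ T) :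
    Reprogrammed F (G.reprogram κ x (F κ x)) H (T.erase (κ, x)) := by
  have key : ∀ x', (κ, x') ∈ T → x' ≠ x →
      G.reprogram κ x (F κ x) κ x' = G κ x' := fun x' hx' hne => by
    rw [Cipher.reprogram_apply, if_pos rfl, Equiv.swap_apply_of_ne_of_ne]
    · exact fun e => hne ((G κ).injective e)
    · exact h.good κ x' x hx' hp
  have keyne : ∀ κ' u, κ' ≠ κ → G.reprogram κ x (F κ x) κ' u = G κ' u := fun κ' u hne => by
    rw [Cipher.reprogram_apply, if_neg hne]
  have mem : ∀ {κ' x'}, (κ', x') ∈ T.erase (κ, x) → (κ', x') ∈ T ∧ (κ' = κ → x' ≠ x) := by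
    intro κ' x' hm
    rw [Finset.mem_erase] at hm
    exact ⟨hm.2, fun h1 h2 => hm.1 (by rw [h1, h2])⟩
  have same : ∀ {κ' x'}, (κ', x') ∈ T.erase (κ, x) →
      G.reprogram κ x (F κ x) κ' x' = G κ' x' := by
    intro κ' x' hm
    obtain ⟨h1, h2⟩ := mem hm
    by_cases hκ : κ' = κ
    · subst hκ
      exact key x' h1 (h2 rfl)
    · exact keyne _ _ hκ
  refine ⟨fun κ' x' hm => h.value κ' x' (mem hm).1, fun κ' x' hm => ?_, fun κ' u h1 h2 => ?_,
    fun κ' x₁ x₂ h1 h2 => ?_⟩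
  · obtain ⟨h1, h2⟩ := mem hm
    rw [same hm]
    have e : (G.reprogram κ x (F κ x) κ').symm (F κ' x') = (G κ').symm (F κ' x') := by
      rw [Equiv.symm_apply_eq]
      by_cases hκ : κ' = κ
      · subst hκ
        rw [Cipher.reprogram_apply, if_pos rfl, Equiv.apply_symm_apply,
          Equiv.swap_apply_of_ne_of_ne]
        · exact (h.good _ _ _ hp h1).symm
        · exact fun e => h2 rfl ((F κ').injective e)
      · rw [keyne _ _ hκ, Equiv.apply_symm_apply]
    rw [e]
    exact h.swapped _ _ h1
  · by_cases hκ : κ' = κ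
    · subst hκ
      rw [Cipher.reprogram_apply, if_pos rfl] at h2 ⊢
      by_cases hu : u = x
      · subst hu
        rw [Equiv.swap_apply_left]
        exact h.value _ _ hp
      by_cases hv : G κ' u = F κ' x
      · rw [hv, Equiv.swap_apply_right, ← h.swapped _ _ hp, ← hv, Equiv.symm_apply_apply]
      · have hs : Equiv.swap (G κ' x) (F κ' x) (G κ' u) = G κ' u :=
          Equiv.swap_apply_of_ne_of_ne (fun e => hu ((G κ').injective e)) hv
        rw [hs] at h2 ⊢
        refine h.other _ _ (fun hm => h1 ?_) (fun hm => h2 ?_)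
        · simp [hm, hu]
        · simp [hm, Equiv.symm_apply_eq, hv]
    · rw [keyne _ _ hκ] at h2 ⊢
      refine h.other _ _ (fun hm => h1 ?_) (fun hm => h2 ?_)
      · simp [hm, hκ]
      · simp [hm, hκ]
  · rw [same h1]
    exact h.good _ _ _ (mem h1).1 (mem h2).1

end Reprogrammed

/-- For `s = true` the answer of `G` is one of `x` and `F x`, and the opposite query to `F` there
returns the other. So all four inputs reveal the same point. -/
theorem Cipher.update_inputOf (F G : Cipher K X) (p : K × X) (b s : Bool) :
    F.update G s (F.inputOf G p b s) = G.reprogram p.1 p.2 (F p.1 p.2) := by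
  cases b <;> cases s <;> simp [update, companion, inputOf, learn, answer]

namespace Reprogrammed

variable {F G H : Cipher K X} {T : Finset (K × X)}

theorem answer_inputOf (h : Reprogrammed F G H T) {p : K × X} (hp : p ∈ T) {b : Bool} {κ : K}
    {u : X} {s : Bool} (e : (b, κ, u) = F.inputOf G p b s) :
    H.answer b κ u = (G.reprogram p.1 p.2 (F p.1 p.2)).answer b κ u := by
  obtain ⟨κ', x⟩ := p
  simp only [Cipher.inputOf, Prod.mk.injEq, true_and] at e
  obtain ⟨rfl, rfl⟩ := e
  have h1 := h.value _ _ hp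
  have h2 := h.swapped _ _ hp
  have key : ∀ v, G.reprogram κ x (F κ x) κ v = Equiv.swap (G κ x) (F κ x) (G κ v) := fun v => by
    rw [Cipher.reprogram_apply, if_pos rfl]
  cases b <;> cases s <;> simp only [Cipher.answer, if_true, Bool.false_eq_true, if_false]
  · rw [key, Equiv.swap_apply_left, h1]
  · rw [key, Equiv.apply_symm_apply, Equiv.swap_apply_right, h2]
  · rw [Equiv.symm_apply_eq, ← h1, eq_comm, Equiv.apply_eq_iff_eq, Equiv.symm_apply_eq, h1, key,
      Equiv.swap_apply_left]
  · rw [Equiv.symm_apply_eq, ← h2, eq_comm, Equiv.apply_eq_iff_eq, h2, Equiv.symm_apply_eq, key,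
      Equiv.apply_symm_apply, Equiv.swap_apply_right]

variable {W : Type*} [Fintype K] [Fintype X] [Fintype W] [AddGroup X]

/-- The inputs attached to `T` are pairwise distinct, so at each basis state at most one correction
is felt, and it replaces the answer of `G` by that of `H`. -/
theorem oracle_eq (h : Reprogrammed F G H T) (φ : EuclideanSpace ℂ (BasisState K X W)) :
    H.oracle W φ = G.oracle W φ +
      ∑ j ∈ (T ×ˢ (Finset.univ : Finset (Bool × Bool))) ×ˢ (Finset.univ : Finset Bool),
        (if j.2 then (1 : ℂ) else -1) •
          (if j.2 then G.reprogram j.1.1.1 j.1.1.2 (F j.1.1.1 j.1.1.2) else G).oracle W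
            (projectInput (F.inputOf G j.1.1 j.1.2.1 j.1.2.2) φ) := by
  ext ⟨b, κ, u, y, w⟩
  have hproj : ∀ (E : Cipher K X) (a : Bool × K × X),
      E.oracle W (projectInput a φ) (b, κ, u, y, w) =
        if (b, κ, u) = a then φ (b, κ, u, y - E.answer b κ u, w) else 0 := fun E a => by
    rw [Cipher.oracle_apply, projectInput, restrictTo_apply]
    simp only [BasisState.input, Set.mem_ofPred_eq]
    congr
  rw [Finset.sum_product, PiLp.add_apply, WithLp.ofLp_sum, Finset.sum_apply]
  simp only [Fintype.sum_bool, if_true, Bool.false_eq_true, if_false, one_smul, neg_smul,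
    PiLp.add_apply, PiLp.neg_apply, hproj]
  by_cases hu : ∃ p ∈ T, ∃ s, (b, κ, u) = F.inputOf G p b s
  · obtain ⟨p, hp, s, e⟩ := hu
    rw [Finset.sum_eq_single_of_mem (p, b, s) (by simp [hp])]
    · simp only [Cipher.oracle_apply]
      rw [if_pos e, if_pos e, h.answer_inputOf hp e]
      ring
    · rintro ⟨p', b', s'⟩ hj hne
      have hp' : p' ∈ T := by simpa using hj
      have : (b, κ, u) ≠ F.inputOf G p' b' s' := fun e' => hne <| by
        obtain ⟨rfl, rfl, rfl⟩ := h.inputOf_injective hp hp' (e.symm.trans e')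
        rfl
      simp [this]
  · push Not at hu
    rw [Finset.sum_eq_zero, add_zero, Cipher.oracle_apply, Cipher.oracle_apply, h.answer_eq hu]
    rintro ⟨p', b', s'⟩ hj
    have hp' : p' ∈ T := by simpa using hj
    have : (b, κ, u) ≠ F.inputOf G p' b' s' := fun e' => by
      have hb : b = b' := congrArg Prod.fst e'
      subst hb
      exact hu p' hp' s' e'
    simp [this]

/-- Expanding the next query by `oracle_eq` gives one branch with `T` unchanged and 8 per point of
`T` with that point erased: four inputs, two oracles each. Weighted Cauchy–Schwarz adds up the
inductive bounds. -/
theorem weightOn_evolve_le (h : Reprogrammed F G H T) (Γ : Set (BasisState K X W))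
    (Us : List (EuclideanSpace ℂ (BasisState K X W) ≃ₗᵢ[ℂ] EuclideanSpace ℂ (BasisState K X W)))
    {m : ℕ} (hm : T.card ≤ m) (φ : EuclideanSpace ℂ (BasisState K X W)) :
    weightOn Γ (evolve H Us φ) ≤ (8 * (Us.length : ℝ) + 1) ^ T.card * simWeight Γ F Us m G φ := by
  induction Us generalizing m G T φ with
  | nil => simp [evolve_nil, simWeight]
  | cons U Us ih =>
    have hx : (1 : ℝ) ≤ 8 * Us.length + 1 := by
      have : (0 : ℝ) ≤ Us.length := Nat.cast_nonneg _
      linarith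
    cases m with
    | zero =>
      obtain rfl : T = ∅ := by simpa using hm
      have := ih h hm (U (G.oracle W φ))
      rw [h.eq_of_empty] at this ⊢
      simpa [evolve_cons, simWeight] using this
    | succ m =>
      set J := (T ×ˢ (Finset.univ : Finset (Bool × Bool))) ×ˢ (Finset.univ : Finset Bool) with hJ
      let G' : ((K × X) × Bool × Bool) × Bool → Cipher K X := fun j =>
        G.reprogram j.1.1.1 j.1.1.2 (F j.1.1.1 j.1.1.2)
      let ψ : ((K × X) × Bool × Bool) × Bool → EuclideanSpace ℂ (BasisState K X W) := fun j =>
        U ((if j.2 then G' j else G).oracle W (projectInput (F.inputOf G j.1.1 j.1.2.1 j.1.2.2) φ))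
      have hsum : evolve H (U :: Us) φ = ∑ o ∈ J.insertNone,
          o.elim (evolve H Us (U (G.oracle W φ)))
            fun j => (if j.2 then (1 : ℂ) else -1) • evolve H Us (ψ j) := by
        rw [Finset.sum_insertNone, evolve_cons, h.oracle_eq]
        simp only [map_add, map_sum, map_smul, Option.elim]
        rfl
      have hle := weightOn_sum_le Γ J.insertNone
        (fun o => o.elim (evolve H Us (U (G.oracle W φ)))
            fun j => (if j.2 then (1 : ℂ) else -1) • evolve H Us (ψ j))
        (A := fun o => o.elim ((8 * (Us.length : ℝ) + 1) ^ T.card)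
          fun _ => (8 * (Us.length : ℝ) + 1) ^ (T.card - 1))
        (α := fun o => o.elim (simWeight Γ F Us (m + 1) G (U (G.oracle W φ)))
          fun j => simWeight Γ F Us m (G' j) (ψ j)) ?_ ?_ ?_
      · rw [hsum]
        refine hle.trans (mul_le_mul ?_ ?_ ?_ (by positivity))
        · rw [Finset.sum_insertNone]
          simp only [Option.elim, Finset.sum_const, hJ, Finset.card_product, Finset.card_univ,
            Fintype.card_prod, Fintype.card_bool, nsmul_eq_mul, List.length_cons]
          -- The truncated `T.card - 1` is harmless for empty `T`, since then `J` is empty.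
          rcases Nat.eq_zero_or_pos T.card with h0 | h0
          · simp [h0]
          · obtain ⟨t, ht⟩ : ∃ t, T.card = t + 1 := ⟨T.card - 1, by omega⟩
            rw [ht, Nat.add_sub_cancel]
            have hb := pow_succ_add_mul_le (zero_le_one.trans hx) (by norm_num : (0 : ℝ) ≤ 8) t
            have he : 8 * (Us.length : ℝ) + 1 + 8 = 8 * (Us.length + 1) + 1 := by ring
            rw [he] at hb
            push_cast
            linarith
        · rw [Finset.sum_insertNone, simWeight]
          refine add_le_add le_rfl ?_
          -- `simWeight` sums over all inputs; those of `T` occur once each, and the others only add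
          -- nonnegative terms.
          let g : ((K × X) × Bool × Bool) × Bool → (Bool × Bool) × (Bool × K × X) := fun j =>
            ((j.1.2.2, j.2), F.inputOf G j.1.1 j.1.2.1 j.1.2.2)
          have hg : Set.InjOn g J := by
            rintro ⟨⟨p, b, s⟩, c⟩ hj ⟨⟨p', b', s'⟩, c'⟩ hj' e
            have hp : p ∈ T := by simpa [hJ] using hj
            have hp' : p' ∈ T := by simpa [hJ] using hj'
            simp only [g, Prod.mk.injEq] at e
            obtain ⟨⟨rfl, rfl⟩, e⟩ := e
            obtain ⟨rfl, rfl, -⟩ := h.inputOf_injective hp hp' e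
            rfl
          have := Finset.sum_image (s := J) (g := g) (f := fun j =>
            simWeight Γ F Us m (F.update G j.1.1 j.2)
              (U ((if j.1.2 then F.update G j.1.1 j.2 else G).oracle W (projectInput j.2 φ)))) hg
          refine le_trans (le_of_eq (Finset.sum_congr rfl fun j _ => ?_)) (this.ge.trans
            (Finset.sum_le_univ_sum_of_nonneg fun j => simWeight_nonneg _ _ _ _ _ _))
          simp only [g, Cipher.update_inputOf]
          rfl
        · exact Finset.sum_nonneg fun o _ => by
            cases o <;> exact simWeight_nonneg _ _ _ _ _ _
      · intro o
        cases o <;> simp only [Option.elim] <;> positivity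
      · intro o
        cases o <;> exact simWeight_nonneg _ _ _ _ _ _
      · intro o ho
        cases o with
        | none => exact ih h hm _
        | some j =>
          have hp : (j.1.1.1, j.1.1.2) ∈ T := by simpa [hJ] using ho
          have h1 := (ih (h.erase hp) (m := m) (by rw [Finset.card_erase_of_mem hp]; omega) (ψ j))
          rw [Finset.card_erase_of_mem hp] at h1
          refine le_trans (le_of_eq ?_) h1
          simp only [Option.elim]
          split_ifs
          · rw [one_smul]
          · rw [neg_smul, one_smul, weightOn_neg]

end Reprogrammed

end Reprogrammed

/-! ### Averaging over ideal ciphers -/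

section Averaging

variable {K X : Type*}

/-- None of the values of `E` on `T` is a value of `F` on `T` with the same key. -/
def GoodPosition (E F : Cipher K X) (T : Finset (K × X)) : Prop :=
  ∀ κ x x', (κ, x) ∈ T → (κ, x') ∈ T → E κ x ≠ F κ x'

variable [DecidableEq K] [DecidableEq X]

/-- The map that exchanges `E κ x` and `F κ x` for every `(κ, x)` in `T`. -/
def exchangeFun (E F : Cipher K X) (T : Finset (K × X)) (κ : K) (v : X) : X :=
  if (κ, (E κ).symm v) ∈ T then F κ ((E κ).symm v)
  else if (κ, (F κ).symm v) ∈ T then E κ ((F κ).symm v) else v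

open Classical in
/-- The map `exchangeFun` as a family of permutations (trivial where the map is no involution). -/
noncomputable def exchange (E F : Cipher K X) (T : Finset (K × X)) : Cipher K X := fun κ =>
  if h : Function.Involutive (exchangeFun E F T κ) then h.toPerm else 1

namespace GoodPosition

variable {E F : Cipher K X} {T : Finset (K × X)}

theorem exchangeFun_left {κ : K} {x : X} (hx : (κ, x) ∈ T) :
    exchangeFun E F T κ (E κ x) = F κ x := by
  simp [exchangeFun, hx]

theorem exchangeFun_right (h : GoodPosition E F T) {κ : K} {x : X} (hx : (κ, x) ∈ T) :
    exchangeFun E F T κ (F κ x) = E κ x := by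
  have : (κ, (E κ).symm (F κ x)) ∉ T := fun hm => h _ _ _ hm hx (by simp)
  simp [exchangeFun, hx, this]

theorem exchangeFun_other {κ : K} {v : X} (h1 : (κ, (E κ).symm v) ∉ T)
    (h2 : (κ, (F κ).symm v) ∉ T) : exchangeFun E F T κ v = v := by
  simp [exchangeFun, h1, h2]

theorem involutive (h : GoodPosition E F T) (κ : K) :
    Function.Involutive (exchangeFun E F T κ) := by
  intro v
  by_cases h1 : (κ, (E κ).symm v) ∈ T
  · obtain ⟨x, rfl⟩ := (E κ).surjective v
    rw [Equiv.symm_apply_apply] at h1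
    rw [exchangeFun_left h1, h.exchangeFun_right h1]
  by_cases h2 : (κ, (F κ).symm v) ∈ T
  · obtain ⟨x, rfl⟩ := (F κ).surjective v
    rw [Equiv.symm_apply_apply] at h2
    rw [h.exchangeFun_right h2, exchangeFun_left h2]
  · rw [exchangeFun_other h1 h2, exchangeFun_other h1 h2]

theorem exchange_apply (h : GoodPosition E F T) (κ : K) (v : X) :
    exchange E F T κ v = exchangeFun E F T κ v := by
  rw [exchange, dif_pos (h.involutive κ)]
  rfl

theorem exchange_mul_self (h : GoodPosition E F T) : exchange E F T * exchange E F T = 1 := by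
  funext κ
  ext v
  simp only [Pi.mul_apply, Equiv.Perm.mul_apply, h.exchange_apply]
  exact h.involutive κ v

theorem exchange_mul_left (h : GoodPosition E F T) {κ : K} {x : X} (hx : (κ, x) ∈ T) :
    (exchange E F T * E) κ x = F κ x := by
  rw [Pi.mul_apply, Equiv.Perm.mul_apply, h.exchange_apply, exchangeFun_left hx]

theorem exchange_mul_right (h : GoodPosition E F T) {κ : K} {x : X} (hx : (κ, x) ∈ T) :
    (exchange E F T * F) κ x = E κ x := by
  rw [Pi.mul_apply, Equiv.Perm.mul_apply, h.exchange_apply, h.exchangeFun_right hx]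

theorem reprogrammed (h : GoodPosition E F T) :
    Reprogrammed F E (exchange E F T * E) T where
  value _ _ hx := h.exchange_mul_left hx
  swapped κ x hx := by
    rw [Pi.mul_apply, Equiv.Perm.mul_apply, Equiv.apply_symm_apply, h.exchange_apply,
      h.exchangeFun_right hx]
  other κ u h1 h2 := by
    rw [Pi.mul_apply, Equiv.Perm.mul_apply, h.exchange_apply, exchangeFun_other _ h2]
    rwa [Equiv.symm_apply_apply]
  good := h

theorem exchange_mul (h : GoodPosition E F T) :
    GoodPosition (exchange E F T * E) (exchange E F T * F) T := by
  intro κ x x' hx hx'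
  rw [h.exchange_mul_left hx, h.exchange_mul_right hx']
  exact (h κ x' x hx' hx).symm

/-- The exchanged pair defines the same involution, so exchanging twice restores the pair. -/
theorem exchange_exchange_mul (h : GoodPosition E F T) :
    exchange (exchange E F T * E) (exchange E F T * F) T = exchange E F T := by
  funext κ
  ext v
  rw [h.exchange_mul.exchange_apply, h.exchange_apply]
  by_cases h1 : (κ, (E κ).symm v) ∈ T
  · obtain ⟨x, rfl⟩ := (E κ).surjective v
    rw [Equiv.symm_apply_apply] at h1
    rw [exchangeFun_left h1, ← h.exchange_mul_left h1, ← h.exchange_mul_right h1,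
      h.exchange_mul.exchangeFun_right h1]
  by_cases h2 : (κ, (F κ).symm v) ∈ T
  · obtain ⟨x, rfl⟩ := (F κ).surjective v
    rw [Equiv.symm_apply_apply] at h2
    rw [h.exchangeFun_right h2, ← h.exchange_mul_left h2, ← h.exchange_mul_right h2,
      exchangeFun_left h2]
  · have hv : exchange E F T κ v = v := by rw [h.exchange_apply, exchangeFun_other h1 h2]
    have hsymm : (exchange E F T κ).symm v = v := by rw [Equiv.symm_apply_eq, hv]
    rw [exchangeFun_other h1 h2, exchangeFun_other]
    · exact fun hm => h1 (by simpa [Equiv.Perm.mul_def, hsymm] using hm)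
    · exact fun hm => h2 (by simpa [Equiv.Perm.mul_def, hsymm] using hm)

end GoodPosition

variable [Fintype K] [Fintype X]

/-- Composing with a transposition at the key `κ` matches any two fibres of evaluation at `x`. -/
theorem card_cipher_apply_eq (κ : K) (x v : X) :
    Fintype.card X * (Finset.univ.filter fun F : Cipher K X => F κ x = v).card =
      Fintype.card (Cipher K X) := by
  have h : ∀ v', (Finset.univ.filter fun F : Cipher K X => F κ x = v').card =
      (Finset.univ.filter fun F : Cipher K X => F κ x = v).card := by
    intro v'
    have hinv : ∀ F : Cipher K X,
        Pi.mulSingle κ (Equiv.swap v v') * (Pi.mulSingle κ (Equiv.swap v v') * F) = F := by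
      intro F
      rw [← mul_assoc, ← Pi.mulSingle_mul, Equiv.swap_mul_self, Pi.mulSingle_one, one_mul]
    refine Finset.card_nbij' (fun F => Pi.mulSingle κ (Equiv.swap v v') * F)
      (fun F => Pi.mulSingle κ (Equiv.swap v v') * F) ?_ ?_ ?_ ?_
    · intro F hF
      simp only [Finset.coe_filter, Finset.mem_univ, true_and, Set.mem_ofPred_eq] at hF ⊢
      simp [hF]
    · intro F hF
      simp only [Finset.coe_filter, Finset.mem_univ, true_and, Set.mem_ofPred_eq] at hF ⊢
      simp [hF]
    · exact fun F _ => hinv F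
    · exact fun F _ => hinv F
  have hfib := Finset.card_eq_sum_card_fiberwise (s := (Finset.univ : Finset (Cipher K X)))
    (t := Finset.univ) (f := fun F => F κ x) fun _ _ => Finset.mem_coe.2 (Finset.mem_univ _)
  rw [Finset.card_univ] at hfib
  rw [hfib, Finset.sum_congr rfl fun v' _ => h v', Finset.sum_const, Finset.card_univ,
    smul_eq_mul]

open Classical in
-- Union bound over at most k² pairs of points, each colliding with probability at most 1/|X|.
theorem card_goodPosition_ge [Nonempty X] (E : Cipher K X) {T : Finset (K × X)} {k : ℕ}
    (hT : T.card ≤ k) :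
    (1 - (k : ℝ) ^ 2 / Fintype.card X) * Fintype.card (Cipher K X) ≤
      (Finset.univ.filter fun F => GoodPosition E F T).card := by
  have hN : (0 : ℝ) < Fintype.card X := by exact_mod_cast Fintype.card_pos
  have hbad : (Finset.univ.filter fun F => ¬ GoodPosition E F T) ⊆
      (T ×ˢ T).biUnion fun p =>
        Finset.univ.filter fun F : Cipher K X => F p.2.1 p.2.2 = E p.1.1 p.1.2 := by
    intro F hF
    have hF := (Finset.mem_filter.1 hF).2
    unfold GoodPosition at hF
    push Not at hF
    obtain ⟨κ, x, x', hx, hx', e⟩ := hF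
    simp only [Finset.mem_biUnion, Finset.mem_filter, Finset.mem_univ, true_and]
    exact ⟨((κ, x), (κ, x')), Finset.mem_product.2 ⟨hx, hx'⟩, e.symm⟩
  have hcard := (Finset.card_le_card hbad).trans Finset.card_biUnion_le
  have hle : ((Finset.univ.filter fun F => ¬ GoodPosition E F T).card : ℝ) ≤
      (k : ℝ) ^ 2 / Fintype.card X * Fintype.card (Cipher K X) := by
    have h1 : ∀ p : (K × X) × (K × X),
        ((Finset.univ.filter fun F : Cipher K X => F p.2.1 p.2.2 = E p.1.1 p.1.2).card : ℝ) =
          Fintype.card (Cipher K X) / Fintype.card X := by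
      intro p
      rw [eq_div_iff hN.ne', mul_comm]
      exact_mod_cast card_cipher_apply_eq _ _ _
    have h2 : ((Finset.univ.filter fun F => ¬ GoodPosition E F T).card : ℝ) ≤
        ∑ p ∈ T ×ˢ T, ((Finset.univ.filter fun F : Cipher K X =>
          F p.2.1 p.2.2 = E p.1.1 p.1.2).card : ℝ) := by exact_mod_cast hcard
    refine h2.trans ?_
    simp only [h1, Finset.sum_const, Finset.card_product, nsmul_eq_mul]
    have hk : (T.card : ℝ) ≤ k := by exact_mod_cast hT
    have hk2 : (T.card : ℝ) * T.card ≤ (k : ℝ) ^ 2 := by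
      rw [sq]; exact mul_self_le_mul_self (Nat.cast_nonneg _) hk
    rw [div_mul_eq_mul_div, ← mul_div_assoc]
    push_cast
    gcongr
  have htot : ((Finset.univ.filter fun F => GoodPosition E F T).card : ℝ) +
      (Finset.univ.filter fun F => ¬ GoodPosition E F T).card = Fintype.card (Cipher K X) := by
    rw [← Finset.card_univ]
    exact_mod_cast Finset.card_filter_add_card_filter_not _
  linarith

open Classical in
-- The exchange permutes the good pairs, so `w` may be evaluated at the first cipher itself; the
-- second is then merely counted.
theorem sum_goodPosition_ge [Nonempty X] {T : Finset (K × X)} {k : ℕ} (hT : T.card ≤ k)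
    (w : Cipher K X → ℝ) (hw : ∀ H, 0 ≤ w H) :
    (1 - (k : ℝ) ^ 2 / Fintype.card X) * Fintype.card (Cipher K X) * ∑ H, w H ≤
      ∑ p : Cipher K X × Cipher K X,
        if GoodPosition p.1 p.2 T then w (exchange p.1 p.2 T * p.1) else 0 := by
  rw [← Finset.sum_filter]
  have hbij : ∑ p ∈ Finset.univ.filter fun p : Cipher K X × Cipher K X =>
        GoodPosition p.1 p.2 T, w (exchange p.1 p.2 T * p.1) =
      ∑ p ∈ Finset.univ.filter fun p : Cipher K X × Cipher K X =>
        GoodPosition p.1 p.2 T, w p.1 := by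
    have hinv : ∀ p ∈ Finset.univ.filter fun p : Cipher K X × Cipher K X =>
        GoodPosition p.1 p.2 T,
        (exchange (exchange p.1 p.2 T * p.1) (exchange p.1 p.2 T * p.2) T *
            (exchange p.1 p.2 T * p.1),
          exchange (exchange p.1 p.2 T * p.1) (exchange p.1 p.2 T * p.2) T *
            (exchange p.1 p.2 T * p.2)) = p := by
      intro p hp
      have hp := (Finset.mem_filter.1 hp).2
      rw [hp.exchange_exchange_mul, ← mul_assoc, ← mul_assoc, hp.exchange_mul_self, one_mul,
        one_mul]
    refine Finset.sum_nbij' (fun p => (exchange p.1 p.2 T * p.1, exchange p.1 p.2 T * p.2))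
      (fun p => (exchange p.1 p.2 T * p.1, exchange p.1 p.2 T * p.2)) ?_ ?_ hinv hinv
      fun _ _ => rfl
    all_goals
      intro p hp
      simp only [Finset.mem_filter, Finset.mem_univ, true_and] at hp ⊢
      exact hp.exchange_mul
  rw [hbij, Finset.sum_filter, Fintype.sum_prod_type, Finset.mul_sum]
  refine Finset.sum_le_sum fun H _ => ?_
  simp only
  rw [← Finset.sum_filter, Finset.sum_const, nsmul_eq_mul]
  exact mul_le_mul_of_nonneg_right (card_goodPosition_ge H hT) (hw H)

end Averaging

/-! ### Assembly of the bound -/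

/-- The finite set of points `(K₁, x₁), …, (K_k, x_k)`. -/
def outputPoints {K X : Type*} [DecidableEq K] [DecidableEq X] {k : ℕ} (κ : Fin k → K)
    (x : Fin k → X) : {T : Finset (K × X) // T.card ≤ k} :=
  ⟨Finset.univ.image fun i => (κ i, x i), Finset.card_image_le.trans_eq (Finset.card_fin k)⟩

theorem mem_outputPoints {K X : Type*} [DecidableEq K] [DecidableEq X] {k : ℕ} (κ : Fin k → K)
    (x : Fin k → X) (i : Fin k) : (κ i, x i) ∈ (outputPoints κ x).1 :=
  Finset.mem_image_of_mem _ (Finset.mem_univ i)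

theorem weightOn_eq_sum_fiber {K X W : Type*} [Fintype K] [Fintype X] [Fintype W] {ι : Type*}
    [Fintype ι] (p : BasisState K X W → ι) (Γ : Set (BasisState K X W))
    (φ : EuclideanSpace ℂ (BasisState K X W)) :
    weightOn Γ φ = ∑ t, weightOn (Γ ∩ p ⁻¹' {t}) φ := by
  classical
  simp only [weightOn]
  rw [Finset.sum_comm]
  refine Finset.sum_congr rfl fun i _ => ?_
  by_cases h : i ∈ Γ <;> simp [h]

theorem mainTheorem3 {K X Z : Type*} [Fintype K] [DecidableEq K] [Fintype X] [DecidableEq X]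
    [AddGroup X] (k q : ℕ)
    (A : QuantumAlgorithm K X ((Fin k → K) × (Fin k → X) × Z) q)
    (R : Set ((Fin k → K) × (Fin k → X) × (Fin k → X) × Z)) :
    ∃ B : ClassicalAlgorithm K X ((Fin k → K) × (Fin k → X) × Z) k,
      idealCipherExpectation K X (fun E => B.outputProb E (winningOutputs R E)) ≥
        (1 - (k : ℝ) ^ 2 / (Fintype.card X : ℝ)) / (8 * (q : ℝ) + 1) ^ (2 * k) *
          idealCipherExpectation K X (fun E => A.outputProb E (winningOutputs R E)) := by
  classical
  obtain ⟨i₀⟩ : Nonempty (BasisState K X A.W) := by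
    by_contra h
    rw [not_nonempty_iff] at h
    have := A.norm_start
    rw [Subsingleton.elim A.start 0, norm_zero] at this
    exact zero_ne_one this
  have : Nonempty ((Fin k → K) × (Fin k → X) × Z) := ⟨A.out i₀⟩
  have : Nonempty X := ⟨i₀.2.2.1⟩
  set Us := List.ofFn A.unitary
  have hlen : Us.length = q := List.length_ofFn
  set D : ℝ := (8 * (q : ℝ) + 1) ^ k with hD
  have hDpos : 0 < D := by positivity
  set C : ℝ := ((Fintype.card (Cipher K X) : ℕ) : ℝ) with hC
  have hCpos : 0 < C := by
    rw [hC]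
    exact_mod_cast Fintype.card_pos
  let Γ : Cipher K X → Set (BasisState K X A.W) := fun F => A.out ⁻¹' winningOutputs R F
  let pts : BasisState K X A.W → {T : Finset (K × X) // T.card ≤ k} := fun i =>
    outputPoints (A.out i).1 (A.out i).2.1
  -- Every `G` has the same budget `D`, so the mixture draws `G` uniformly.
  obtain ⟨-, B, hB⟩ := Achieves.sum fun G : Cipher K X =>
    achieves_simWeight (winningOutputs R) A.out Us k G A.start
  refine ⟨B, ?_⟩
  simp only [A.norm_start, hlen, one_pow, mul_one, Finset.sum_const, Finset.card_univ,
    nsmul_eq_mul] at hB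
  have hupper : ∑ F : Cipher K X, ∑ G : Cipher K X, simWeight (Γ F) F Us k G A.start ≤
      C * D * ∑ F, B.outputProb F (winningOutputs R F) := by
    rw [Finset.mul_sum]
    exact Finset.sum_le_sum fun F _ => hB F
  have hlower : ∀ (T : {T : Finset (K × X) // T.card ≤ k}) (G F : Cipher K X),
      (if GoodPosition G F T.1 then weightOn (Γ (exchange G F T.1 * G) ∩ pts ⁻¹' {T})
        (evolve (exchange G F T.1 * G) Us A.start) else 0) ≤
      D * simWeight (Γ F ∩ pts ⁻¹' {T}) F Us k G A.start := by
    intro T G F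
    split_ifs with h
    -- Winning depends only on the values at the output points, which form `T`.
    · have hΓ : Γ (exchange G F T.1 * G) ∩ pts ⁻¹' {T} = Γ F ∩ pts ⁻¹' {T} := by
        ext i
        refine and_congr_left fun hi => ?_
        have hi : pts i = T := hi
        have hv : (fun j => (exchange G F T.1 * G) ((A.out i).1 j) ((A.out i).2.1 j)) =
            fun j => F ((A.out i).1 j) ((A.out i).2.1 j) := by
          funext j
          refine h.exchange_mul_left ?_
          rw [← hi]
          exact mem_outputPoints _ _ j
        change (_, _, _, _) ∈ R ↔ (_, _, _, _) ∈ R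
        rw [hv]
      rw [hΓ]
      refine (h.reprogrammed.weightOn_evolve_le _ Us T.2 A.start).trans ?_
      refine mul_le_mul_of_nonneg_right ?_ (simWeight_nonneg _ _ _ _ _ _)
      rw [hlen]
      exact pow_le_pow_right₀ (by linarith [(Nat.cast_nonneg q : (0 : ℝ) ≤ q)]) T.2
    · exact mul_nonneg hDpos.le (simWeight_nonneg _ _ _ _ _ _)
  have hmain : (1 - (k : ℝ) ^ 2 / Fintype.card X) * C *
        ∑ H : Cipher K X, A.outputProb H (winningOutputs R H) ≤
      D * ∑ F : Cipher K X, ∑ G : Cipher K X, simWeight (Γ F) F Us k G A.start := by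
    calc _ = ∑ T : {T : Finset (K × X) // T.card ≤ k},
            (1 - (k : ℝ) ^ 2 / Fintype.card X) * C *
              ∑ H : Cipher K X, weightOn (Γ H ∩ pts ⁻¹' {T}) (evolve H Us A.start) := by
          rw [← Finset.mul_sum, Finset.sum_comm]
          congr 1
          refine Finset.sum_congr rfl fun H _ => ?_
          rw [A.outputProb_eq_weightOn, weightOn_eq_sum_fiber pts]
      _ ≤ ∑ T : {T : Finset (K × X) // T.card ≤ k}, ∑ p : Cipher K X × Cipher K X,
            D * simWeight (Γ p.2 ∩ pts ⁻¹' {T}) p.2 Us k p.1 A.start :=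
          Finset.sum_le_sum fun T _ =>
            (sum_goodPosition_ge T.2 _ fun H => weightOn_nonneg _ _).trans
              (Finset.sum_le_sum fun p _ => hlower T p.1 p.2)
      _ = _ := by
          rw [Finset.sum_comm, Fintype.sum_prod_type_right, Finset.mul_sum]
          refine Finset.sum_congr rfl fun F _ => ?_
          rw [Finset.mul_sum]
          refine Finset.sum_congr rfl fun G _ => ?_
          rw [← Finset.mul_sum, ← simWeight_eq_sum_fiber pts]
  have hfinal : (1 - (k : ℝ) ^ 2 / Fintype.card X) *
        ∑ H : Cipher K X, A.outputProb H (winningOutputs R H) ≤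
      -- One factor `D` comes from Cauchy–Schwarz in `hmain`, the other from branch sampling in
      -- `hupper`.
      D ^ 2 * ∑ F, B.outputProb F (winningOutputs R F) := by
    refine le_of_mul_le_mul_left ?_ hCpos
    calc _ = (1 - (k : ℝ) ^ 2 / Fintype.card X) * C *
          ∑ H : Cipher K X, A.outputProb H (winningOutputs R H) := by ring
      _ ≤ _ := hmain
      _ ≤ D * (C * D * ∑ F, B.outputProb F (winningOutputs R F)) :=
          mul_le_mul_of_nonneg_left hupper hDpos.le
      _ = _ := by ring
  have hpow : (8 * (q : ℝ) + 1) ^ (2 * k) = D ^ 2 := by rw [hD, ← pow_mul, mul_comm k 2]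
  rw [ge_iff_le, idealCipherExpectation, idealCipherExpectation, hpow, ← hC, ← mul_div_assoc]
  refine div_le_div_of_nonneg_right ?_ hCpos.le
  rw [div_mul_eq_mul_div, div_le_iff₀ (by positivity), mul_comm _ (D ^ 2)]
  exact hfinal
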